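/- Let $\mathcal X,\mathcal Z$ be finite alphabets and put $\mathcal Y=\mathcal X$. Let $\mathbf X=(X_i)_{i\in\mathbb Z}$ be a stationary ergodic process with values in $\mathcal X$, and let $\mathbf Z=(Z_i)_{i\in\mathbb Z}$ be the $\mathcal Z$-valued process obtained by passing $\mathbf X$ through a memoryless channel with transition probabilities $p_{Z|X}(z|x)$. Assume that the channel matrix $\big(p_{Z|X}(z|x)\big)_{x\in\mathcal X,\,z\in\mathcal Z}$, whose rows are indexed by the inputs $x$, has full row rank $|\mathcal X|$. Let $$\rho(z,y)=-\log p_{Z|X}(z|y)\in[0,\infty],\qquad \rho_n(z^n,y^n)=\frac1n\sum_{i=1}^n\rho(z_i,y_i),\qquad D=H(Z_0|X_0),$$ and let $$R(Z^k,D)=\inf_{P_{Y^k|Z^k}:\ \mathbb E[\rho_k(Z^k,Y^k)]\le D}\ \frac1k I(Z^k;Y^k),$$ where $V^k=(V_1,\dots,V_k)$ for every sequence $V$. Then the limit $R:=R(\mathbf Z,D)=\lim_{k\to\infty}R(Z^k,D)$ exists and is finite, and the following holds. For each $n$ let $Y^n=(Y^{(n)}_1,\dots,Y^{(n)}_n)$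 be a random vector with values in $\mathcal X^n$, defined on the same probability space (for instance $Y^n=\phi_n(Z^n)$ for a deterministic or randomized code $\phi_n$), and suppose that the sequence $(Y^n)_n$ is good at $(R,D)$, that is, $$\limsup_{n\to\infty}\frac1nH(Y^n)\le R\qquad\text{and}\qquad\limsup_{n\to\infty}\mathbb E\big[\rho_n(Z^n,Y^n)\big]\le D.$$ For $1\le k\le n$ let $$Q^{(n)}_{Z^k,Y^k}(z^k,y^k)=\mathbb E\Big[\frac1{n-k+1}\sum_{i=1}^{n-k+1}\mathbf 1\{(Z_i,\dots,Z_{i+k-1})=z^k,\ (Y^{(n)}_i,\dots,Y^{(n)}_{i+k-1})=y^k\}\Big]$$ be the expected $k$-th order joint empirical distribution. Then for every $k\ge1$, $$Q^{(n)}_{Z^k,Y^k}\longrightarrow P_{Z^k,X^k}\qquad\text{as }n\to\infty .$$ In particular, the compressor asymptotically samples from the posterior: for all $z^k\in\mathcal Z^k$ with $P(Z^k=z^k)>0$ and all $x^k\in\mathcal X^k$, the conditional probabilities $Q^{(n)}_{Y^k|Z^k}(x^k|z^k)$ converge to $P(X^k=x^k\mid Z^k=z^k)$. -/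

import Mathlib

open MeasureTheory Filter Topology
open scoped ENNReal

namespace CompressionDenoising

/-- A row-stochastic matrix: `W x z` is the probability of the output `z` given the input `x`. -/
def IsChannel {α β : Type*} [Fintype β] (W : Matrix α β ℝ) : Prop :=
  (∀ x z, 0 ≤ W x z) ∧ ∀ x, ∑ z, W x z = 1

/-- The probability mass function of a random variable `V`. -/
noncomputable def pmfOf {Ω α : Type*} [MeasurableSpace Ω] (μ : Measure Ω) (V : Ω → α) (a : α) : ℝ :=
  μ.real (V ⁻¹' {a})

/-- Shannon entropy `H(V)` (in nats) of a random variable with values in a finite set. -/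
noncomputable def entropy {Ω α : Type*} [MeasurableSpace Ω] [Fintype α] (μ : Measure Ω)
    (V : Ω → α) : ℝ :=
  ∑ a, Real.negMulLog (pmfOf μ V a)

/-- Conditional entropy `H(V | U) = ∑ᵤ P(U = u) H(V | U = u)`. -/
noncomputable def condEntropy {Ω α β : Type*} [MeasurableSpace Ω] [Fintype α] [Fintype β]
    (μ : Measure Ω) (V : Ω → α) (U : Ω → β) : ℝ :=
  ∑ u, pmfOf μ U u *
    ∑ v, Real.negMulLog (pmfOf μ (fun ω => (V ω, U ω)) (v, u) / pmfOf μ U u)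

/-- Mutual information (in nats) of the two coordinates under a joint probability mass
function `q`. Terms with `q a b = 0` vanish. -/
noncomputable def mutualInfo {α β : Type*} [Fintype α] [Fintype β] (q : α → β → ℝ) : ℝ :=
  ∑ a, ∑ b, q a b * Real.log (q a b / ((∑ b', q a b') * ∑ a', q a' b))

/-- The left shift on two-sided sequences. -/
def shift {α : Type*} (x : ℤ → α) : ℤ → α := fun i => x (i + 1)

/-- The first `n` symbols `V₁, …, Vₙ` of a two-sided process. -/
def block {Ω α : Type*} (V : ℤ → Ω → α) (n : ℕ) (ω : Ω) : Fin n → α :=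
  fun i => V ((i : ℤ) + 1) ω

/-- `Z` is the output of the memoryless channel `W` with input `X`: for every finite window of
times `m, …, m + n - 1`, `P(Xs = x, Zs = z) = P(Xs = x) ∏ᵢ W(zᵢ | xᵢ)`. -/
def IsMemorylessOutput {Ω α β : Type*} [MeasurableSpace Ω] (μ : Measure Ω) (W : Matrix α β ℝ)
    (X : ℤ → Ω → α) (Z : ℤ → Ω → β) : Prop :=
  ∀ (m : ℤ) (n : ℕ) (x : Fin n → α) (z : Fin n → β),
    μ.real {ω | ∀ i : Fin n, X (m + i) ω = x i ∧ Z (m + i) ω = z i} =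
      μ.real {ω | ∀ i : Fin n, X (m + i) ω = x i} * ∏ i, W (x i) (z i)

/-- The single-letter distortion `ρ(z, y) = -log W(z | y) ∈ [0, ∞]`, equal to `∞` when
`W(z | y) = 0`. -/
noncomputable def logDistortion {α β : Type*} (W : Matrix α β ℝ) (z : β) (y : α) : ℝ≥0∞ :=
  if W y z = 0 then ⊤ else ENNReal.ofReal (-Real.log (W y z))

/-- The block distortion `ρₙ(zⁿ, yⁿ) = (1/n) ∑ᵢ ρ(zᵢ, yᵢ)`. -/
noncomputable def blockDistortion {β γ : Type*} (ρ : β → γ → ℝ≥0∞) {n : ℕ}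
    (z : Fin n → β) (y : Fin n → γ) : ℝ≥0∞ :=
  (∑ i, ρ (z i) (y i)) / n

/-- The rate-distortion function of a block of length `k` with probability mass function `p`:
the infimum of `(1/k) I(Zᵏ; Yᵏ)` over all test channels `V = P(Yᵏ | Zᵏ)` whose expected
distortion is at most `D` (and `+∞` if there is none). -/
noncomputable def rateDistortion {β γ : Type*} [Fintype β] [Fintype γ] (ρ : β → γ → ℝ≥0∞) {k : ℕ}
    (p : (Fin k → β) → ℝ) (D : ℝ≥0∞) : EReal :=
  ⨅ (V : Matrix (Fin k → β) (Fin k → γ) ℝ) (_ : IsChannel V)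
    (_ : ∑ z, ∑ y, ENNReal.ofReal (p z * V z y) * blockDistortion ρ z y ≤ D),
    ((mutualInfo (fun z y => p z * V z y) / k : ℝ) : EReal)

/-- The reconstructions `Y n` (of length `n`) of `Z₁, …, Zₙ` are good at `(R, D)`: the entropy
rate is asymptotically at most `R` and the expected distortion asymptotically at most `D`. -/
def IsGood {Ω β γ : Type*} [MeasurableSpace Ω] [Fintype γ] (μ : Measure Ω) (ρ : β → γ → ℝ≥0∞)
    (Z : ℤ → Ω → β) (Y : (n : ℕ) → Ω → Fin n → γ) (R : ℝ) (D : ℝ≥0∞) : Prop :=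
  limsup (fun n : ℕ => ((entropy μ (Y n) / n : ℝ) : EReal)) atTop ≤ (R : EReal) ∧
  limsup (fun n : ℕ => ∫⁻ ω, blockDistortion ρ (block Z n ω) (Y n ω) ∂μ) atTop ≤ D

/-- The window of length `k` of the word `w` that starts at position `s`. -/
def window {α : Type*} {n k : ℕ} (w : Fin n → α) (s : Fin (n + 1 - k)) : Fin k → α :=
  fun j => w ⟨s + j, by omega⟩

open Classical in
/-- The `k`-th order joint empirical distribution of the words `z` and `y` of length `n`: the
fraction of the `n - k + 1` windows of length `k` in which `z` reads `a` and `y` reads `b`. -/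
noncomputable def empirical {β γ : Type*} {n : ℕ} (k : ℕ) (z : Fin n → β) (y : Fin n → γ)
    (a : Fin k → β) (b : Fin k → γ) : ℝ :=
  (∑ s : Fin (n + 1 - k), if window z s = a ∧ window y s = b then (1 : ℝ) else 0) /
    ((n + 1 - k : ℕ) : ℝ)

/-- The expected `k`-th order joint empirical distribution of `(Z₁, …, Zₙ)` and `Y n`. -/
noncomputable def expEmpirical {Ω β γ : Type*} [MeasurableSpace Ω] (μ : Measure Ω)
    (Z : ℤ → Ω → β) (Y : (n : ℕ) → Ω → Fin n → γ) (k n : ℕ)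
    (a : Fin k → β) (b : Fin k → γ) : ℝ :=
  ∫ ω, empirical k (block Z n ω) (Y n ω) a b ∂μ

end CompressionDenoising

open CompressionDenoising

namespace CompressionDenoising

/-! For a joint law of `(z, y)` and any kernel `r(z|y)`, Gibbs' inequality gives `E log r(Z|Y) ≤
-H(Z|Y)`, and `-H(Z|Y) = I(Z;Y) - H(Z) ≤ H(Y) - H(Z)`.

Taking `r = Wᵏ` in the bound on `I` shows that every test channel of distortion at most `D =
H(Z₀|X₀)` has information at least `H(Zᵏ) - kD`. The true posterior of `Xᵏ` attains this, so `R =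
lim H(Zᵏ)/k - D`; the limit exists by subadditivity. For a good sequence it follows that the gap
`H(Yⁿ) - H(Zⁿ) - E log Wⁿ(Zⁿ|Yⁿ)` is at most `o(n)`.

Now tilt the kernel: `r = ∏ W(zᵢ|yᵢ)(1 + gᵢ)`, where `gᵢ` depends on `z₁,…,zᵢ` and all of `y` and
has conditional mean zero under `W(·|yᵢ)`. The gap then bounds `E ∑ log(1 + gᵢ)`. With `gᵢ = tφ`, a
window function `φ` and small `t`, the window average of every such `φ` must tend to zero
(`sum_window_le`, `AsymptoticallyTight.tendsto_windowMean`).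

A telescoping sum of such `φ` gives `Q(a,b) - Wᵏ(a|b) Q_Y(b) → 0`: in the limit, `Z` looks like the
channel output of `Y`. The `Z`-marginal of `Q` is exactly `P_Z` by stationarity, and full row rank
lets `Wᵏ` be inverted, so `Q_Y → P_X` and hence `Q → P_{Z,X}`. -/

/-- Gibbs' inequality. -/
theorem sum_mul_log_le_sum_mul_log {ι : Type*} [Fintype ι] {p q : ι → ℝ} (hp : ∀ i, 0 ≤ p i)
    (hq : ∀ i, 0 ≤ q i) (hpq : ∀ i, p i ≠ 0 → q i ≠ 0) (h : ∑ i, q i ≤ ∑ i, p i) :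
    ∑ i, p i * Real.log (q i) ≤ ∑ i, p i * Real.log (p i) := by
  have key : ∀ i, p i * Real.log (q i) - p i * Real.log (p i) ≤ q i - p i := by
    intro i
    rcases eq_or_ne (p i) 0 with h0 | h0
    · simp [h0, hq i]
    · have hpos := lt_of_le_of_ne (hp i) (Ne.symm h0)
      have hqpos := lt_of_le_of_ne (hq i) (Ne.symm (hpq i h0))
      have := Real.log_le_sub_one_of_pos (div_pos hqpos hpos)
      rw [Real.log_div hqpos.ne' h0] at this
      have h2 := mul_le_mul_of_nonneg_left this hpos.le
      have h3 : p i * (q i / p i - 1) = q i - p i := by field_simp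
      linarith
  have := Finset.sum_le_sum fun i (_ : i ∈ Finset.univ) => key i
  rw [Finset.sum_sub_distrib, Finset.sum_sub_distrib] at this
  linarith

/-! ### Entropy inequalities and causal product kernels on finite sets -/

section Finite

variable {α β : Type*} [Fintype α] [Fintype β]

/-- Variational form of `I(Z;Y) = H(Z) - H(Z|Y)`: Gibbs' inequality compares `p` with the law
`r(z|y) p(y)`, which has the same `y`-marginal. -/
theorem sum_mul_log_add_entropy_le_mutualInfo {p r : α → β → ℝ} (hp : ∀ z y, 0 ≤ p z y)
    (hr : ∀ z y, 0 ≤ r z y) (hr1 : ∀ y, ∑ z, r z y = 1) (hpr : ∀ z y, p z y ≠ 0 → r z y ≠ 0) :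
    ∑ z, ∑ y, p z y * Real.log (r z y) + ∑ z, Real.negMulLog (∑ y, p z y) ≤ mutualInfo p := by
  have hZ : ∀ z y, p z y ≠ 0 → ∑ y', p z y' ≠ 0 := fun z y h h0 =>
    h ((Finset.sum_eq_zero_iff_of_nonneg fun y _ => hp z y).1 h0 y (Finset.mem_univ _))
  have hY : ∀ z y, p z y ≠ 0 → ∑ z', p z' y ≠ 0 := fun z y h h0 =>
    h ((Finset.sum_eq_zero_iff_of_nonneg fun z _ => hp z y).1 h0 z (Finset.mem_univ _))
  have g := sum_mul_log_le_sum_mul_log (ι := α × β) (p := fun a => p a.1 a.2)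
    (q := fun a => r a.1 a.2 * ∑ z', p z' a.2) (fun a => hp _ _)
    (fun a => mul_nonneg (hr _ _) (Finset.sum_nonneg fun _ _ => hp _ _))
    (fun a h => mul_ne_zero (hpr _ _ h) (hY _ _ h)) (by
      rw [Fintype.sum_prod_type_right, Fintype.sum_prod_type_right]
      simp only [← Finset.sum_mul, hr1, one_mul, le_refl])
  have e1 : ∑ a : α × β, p a.1 a.2 * Real.log (r a.1 a.2 * ∑ z', p z' a.2) =
      ∑ z, ∑ y, p z y * Real.log (r z y) + ∑ z, ∑ y, p z y * Real.log (∑ z', p z' y) := by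
    rw [Fintype.sum_prod_type, ← Finset.sum_add_distrib]
    refine Finset.sum_congr rfl fun z _ => ?_
    rw [← Finset.sum_add_distrib]
    refine Finset.sum_congr rfl fun y _ => ?_
    by_cases h : p z y = 0
    · simp [h]
    · rw [Real.log_mul (hpr _ _ h) (hY _ _ h), mul_add]
  have e2 : mutualInfo p = ∑ a : α × β, p a.1 a.2 * Real.log (p a.1 a.2) +
      ∑ z, Real.negMulLog (∑ y, p z y) - ∑ z, ∑ y, p z y * Real.log (∑ z', p z' y) := by
    rw [mutualInfo, Fintype.sum_prod_type, ← Finset.sum_add_distrib, ← Finset.sum_sub_distrib]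
    refine Finset.sum_congr rfl fun z _ => ?_
    rw [Real.negMulLog, neg_mul, Finset.sum_mul, ← Finset.sum_neg_distrib,
      ← Finset.sum_add_distrib, ← Finset.sum_sub_distrib]
    refine Finset.sum_congr rfl fun y _ => ?_
    by_cases h : p z y = 0
    · simp [h]
    · rw [Real.log_div h (mul_ne_zero (hZ _ _ h) (hY _ _ h)), Real.log_mul (hZ _ _ h) (hY _ _ h)]
      ring
  linarith

/-- Combines the variational bound with `I(Z;Y) ≤ H(Y)`; the latter holds termwise because `p(z,y) ≤
p(z)`. This is how the rate constraint, which concerns `H(Y)`, enters. -/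
theorem sum_mul_log_le_entropy_sub_entropy {p r : α → β → ℝ} (hp : ∀ z y, 0 ≤ p z y)
    (hr : ∀ z y, 0 ≤ r z y) (hr1 : ∀ y, ∑ z, r z y = 1) (hpr : ∀ z y, p z y ≠ 0 → r z y ≠ 0) :
    ∑ z, ∑ y, p z y * Real.log (r z y) ≤
      ∑ y, Real.negMulLog (∑ z, p z y) - ∑ z, Real.negMulLog (∑ y, p z y) := by
  have hZ : ∀ z y, p z y ≠ 0 → ∑ y', p z y' ≠ 0 := fun z y h h0 =>
    h ((Finset.sum_eq_zero_iff_of_nonneg fun y _ => hp z y).1 h0 y (Finset.mem_univ _))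
  have hY : ∀ z y, p z y ≠ 0 → ∑ z', p z' y ≠ 0 := fun z y h h0 =>
    h ((Finset.sum_eq_zero_iff_of_nonneg fun z _ => hp z y).1 h0 z (Finset.mem_univ _))
  have hle := sum_mul_log_add_entropy_le_mutualInfo hp hr hr1 hpr
  have : mutualInfo p ≤ ∑ y, Real.negMulLog (∑ z, p z y) := by
    rw [mutualInfo, Finset.sum_comm]
    refine Finset.sum_le_sum fun y _ => ?_
    rw [Real.negMulLog, neg_mul, Finset.sum_mul, ← Finset.sum_neg_distrib]
    refine Finset.sum_le_sum fun z _ => ?_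
    by_cases h : p z y = 0
    · simp [h]
    · rw [← mul_neg, ← Real.log_inv]
      have hpos := lt_of_le_of_ne (hp z y) (Ne.symm h)
      have hZpos := lt_of_le_of_ne (Finset.sum_nonneg fun y _ => hp z y) (Ne.symm (hZ z y h))
      have hYpos := lt_of_le_of_ne (Finset.sum_nonneg fun z _ => hp z y) (Ne.symm (hY z y h))
      refine mul_le_mul_of_nonneg_left (Real.log_le_log (by positivity) ?_) hpos.le
      rw [← div_div]
      refine (div_le_div_of_nonneg_right ?_ hYpos.le).trans_eq (one_div _)
      exact (div_le_one hZpos).2 (Finset.single_le_sum (f := fun y => p z y)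
        (fun y _ => hp z y) (Finset.mem_univ y))
  linarith

/-- A product of conditional densities, each depending on the past only, is a density. -/
theorem sum_prod_eq_one_of_causal [Nonempty α] : ∀ (n : ℕ) (f : Fin n → (Fin n → α) → ℝ),
    (∀ i z z', (∀ j ≤ i, z j = z' j) → f i z = f i z') →
    (∀ i z, ∑ c, f i (Function.update z i c) = 1) → ∑ z, ∏ i, f i z = 1
  | 0, f, _, _ => by simp
  | n + 1, f, hf, hs => by
    obtain ⟨c₀⟩ := ‹Nonempty α›
    rw [← (Fin.snocEquiv fun _ => α).sum_comp, Fintype.sum_prod_type_right]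
    have he : ∀ (z : Fin n → α) (c : α), Fin.snocEquiv (fun _ : Fin (n + 1) => α) (c, z) =
        Fin.snoc (α := fun _ => α) z c := fun z c => rfl
    simp only [Fin.prod_univ_castSucc, he]
    -- The first `n` factors do not see the last symbol, so it can be frozen at `c₀`; only the last
    -- factor remains under the sum over `c`, which equals one.
    have hc : ∀ (z : Fin n → α) (c : α) (i : Fin n),
        f i.castSucc (Fin.snoc (α := fun _ => α) z c) =
          f i.castSucc (Fin.snoc (α := fun _ => α) z c₀) := fun z c i =>
      hf _ _ _ fun j hj => by
        obtain ⟨j, rfl⟩ : ∃ j' : Fin n, j = j'.castSucc :=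
          ⟨j.castLT (lt_of_le_of_lt hj i.2), rfl⟩
        simp
    simp only [hc, ← Finset.mul_sum]
    have h1 : ∀ z : Fin n → α, ∑ c, f (Fin.last n) (Fin.snoc (α := fun _ => α) z c) = 1 := by
      intro z
      rw [← hs (Fin.last n) (Fin.snoc (α := fun _ => α) z c₀)]
      simp [Fin.update_snoc_last]
    simp only [h1, mul_one]
    refine sum_prod_eq_one_of_causal n
      (fun i z => f i.castSucc (Fin.snoc (α := fun _ => α) z c₀)) ?_ ?_
    · intro i z z' h
      refine hf _ _ _ fun j hj => ?_
      obtain ⟨j, rfl⟩ : ∃ j' : Fin n, j = j'.castSucc :=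
        ⟨j.castLT (lt_of_le_of_lt hj i.2), rfl⟩
      simpa using h j (by simpa using hj)
    · intro i z
      simpa [Fin.snoc_update] using hs i.castSucc (Fin.snoc (α := fun _ => α) z c₀)

theorem sum_prod_apply_eq_one {n : ℕ} {w : Fin n → α → ℝ} (hw : ∀ i, ∑ c, w i c = 1) :
    ∑ z : Fin n → α, ∏ i, w i (z i) = 1 := by
  classical
  rw [← Fintype.prod_sum, Finset.prod_congr rfl fun i _ => hw i, Finset.prod_const_one]

/-- From `log x ≥ 1 - 1/x`: the slack is `u²(1 + 2u)/(1 + u)`, nonnegative exactly because `u ≥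
-1/2`. -/
theorem sub_two_mul_sq_le_log_one_add {u : ℝ} (hu : |u| ≤ 1 / 2) :
    u - 2 * u ^ 2 ≤ Real.log (1 + u) := by
  obtain ⟨h1, -⟩ := abs_le.1 hu
  have h := Real.one_sub_inv_le_log_of_pos (show 0 < 1 + u by linarith)
  have h2 : 1 - (1 + u)⁻¹ - (u - 2 * u ^ 2) = u ^ 2 * (1 + 2 * u) / (1 + u) := by
    have : 1 + u ≠ 0 := by linarith
    field_simp
    ring
  have h3 : 0 ≤ u ^ 2 * (1 + 2 * u) / (1 + u) :=
    div_nonneg (mul_nonneg (sq_nonneg _) (by linarith)) (by linarith)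
  linarith

end Finite

/-- The `n`-fold memoryless extension of the channel `W`. -/
def channelPow {α β : Type*} (W : Matrix α β ℝ) {n : ℕ} (x : Fin n → α) (z : Fin n → β) : ℝ :=
  ∏ i, W (x i) (z i)

/-! ### Tilting the memoryless channel by martingale differences -/

section Tilt

variable {𝒳 𝒵 : Type*} {W : Matrix 𝒳 𝒵 ℝ}

open Classical in
/-- The indicator of `v = b` and `uᵢ = aᵢ` for `i < j`, times the probability that the channel
sends `bᵢ` to `aᵢ` for all `i ≥ j`. -/
noncomputable def partialKernel (W : Matrix 𝒳 𝒵 ℝ) {k : ℕ} (a : Fin k → 𝒵) (b : Fin k → 𝒳)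
    (j : ℕ) (u : Fin k → 𝒵) (v : Fin k → 𝒳) : ℝ :=
  if v = b then ∏ i : Fin k,
    (if (i : ℕ) < j then (if u i = a i then 1 else 0) else W (b i) (a i)) else 0

theorem partialKernel_congr {k : ℕ} (a : Fin k → 𝒵) (b : Fin k → 𝒳) (j : ℕ)
    {u u' : Fin k → 𝒵} (v : Fin k → 𝒳) (h : ∀ i : Fin k, (i : ℕ) < j → u i = u' i) :
    partialKernel W a b j u v = partialKernel W a b j u' v := by
  unfold partialKernel
  split_ifs
  · refine Finset.prod_congr rfl fun i _ => ?_
    by_cases hi : (i : ℕ) < j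
    · rw [h i hi]
    · rw [if_neg hi, if_neg hi]
  · rfl

variable [Fintype 𝒵]

theorem channelPow_nonneg (hW : IsChannel W) {n : ℕ} (x : Fin n → 𝒳) (z : Fin n → 𝒵) :
    0 ≤ channelPow W x z :=
  Finset.prod_nonneg fun _ _ => hW.1 _ _

theorem sum_channelPow (hW : IsChannel W) {n : ℕ} (x : Fin n → 𝒳) :
    ∑ z, channelPow W x z = 1 :=
  sum_prod_apply_eq_one fun i => hW.2 (x i)

/-- Perturbing the memoryless channel by a small martingale difference sequence `g` and comparing
entropies. -/
theorem sum_martingale_le [Fintype 𝒳] [Nonempty 𝒵] (hW : IsChannel W) {n : ℕ}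
    {p : (Fin n → 𝒵) → (Fin n → 𝒳) → ℝ} (hp : ∀ z y, 0 ≤ p z y)
    (hpW : ∀ z y, p z y ≠ 0 → channelPow W y z ≠ 0)
    {g : Fin n → (Fin n → 𝒵) → (Fin n → 𝒳) → ℝ} (hg : ∀ i z y, |g i z y| ≤ 1 / 2)
    (hgc : ∀ i z z' y, (∀ j ≤ i, z j = z' j) → g i z y = g i z' y)
    (hg0 : ∀ i z y, ∑ c, W (y i) c * g i (Function.update z i c) y = 0) :
    ∑ z, ∑ y, p z y * ∑ i, (g i z y - 2 * g i z y ^ 2) ≤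
      ∑ y, Real.negMulLog (∑ z, p z y) - ∑ z, Real.negMulLog (∑ y, p z y) -
        ∑ z, ∑ y, p z y * Real.log (channelPow W y z) := by
  have hpos : ∀ i z y, 0 < 1 + g i z y := fun i z y => by
    have := (abs_le.1 (hg i z y)).1
    linarith
  -- The tilted kernel is normalized by causality in `z` and the mean-zero condition. It is
  -- conditioned on the whole word `y`, so `g` may look ahead in `y`.
  have h := sum_mul_log_le_entropy_sub_entropy (p := p)
    (r := fun z y => ∏ i, (W (y i) (z i) * (1 + g i z y))) hp
    (fun z y => Finset.prod_nonneg fun i _ => mul_nonneg (hW.1 _ _) (hpos i z y).le)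
    (fun y => sum_prod_eq_one_of_causal n (fun i z => W (y i) (z i) * (1 + g i z y))
      (fun i z z' hz => by
        show W (y i) (z i) * (1 + g i z y) = W (y i) (z' i) * (1 + g i z' y)
        rw [hgc i z z' y hz, hz i le_rfl])
      (fun i z => by
        simp only [Function.update_self, mul_add, mul_one, Finset.sum_add_distrib, hg0, hW.2,
          add_zero]))
    (fun z y hzy => by
      rw [Finset.prod_mul_distrib]
      exact mul_ne_zero (hpW z y hzy) (Finset.prod_ne_zero_iff.2 fun i _ => (hpos i z y).ne'))
  have h2 : ∑ z, ∑ y, p z y * ∑ i, (g i z y - 2 * g i z y ^ 2) +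
      ∑ z, ∑ y, p z y * Real.log (channelPow W y z) ≤
      ∑ z, ∑ y, p z y * Real.log (∏ i, (W (y i) (z i) * (1 + g i z y))) := by
    rw [← Finset.sum_add_distrib]
    refine Finset.sum_le_sum fun z _ => ?_
    rw [← Finset.sum_add_distrib]
    refine Finset.sum_le_sum fun y _ => ?_
    by_cases h0 : p z y = 0
    · simp [h0]
    · rw [← mul_add, Finset.prod_mul_distrib]
      refine mul_le_mul_of_nonneg_left ?_ (hp z y)
      change _ ≤ Real.log (channelPow W y z * ∏ i, (1 + g i z y))
      rw [Real.log_mul (hpW z y h0) (Finset.prod_ne_zero_iff.2 fun i _ => (hpos i z y).ne'),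
        add_comm, Real.log_prod (fun i _ => (hpos i z y).ne')]
      exact add_le_add le_rfl
        (Finset.sum_le_sum fun i _ => sub_two_mul_sq_le_log_one_add (hg i z y))
  linarith

theorem window_update {α : Type*} {n k : ℕ} (z : Fin n → α) (s : Fin (n + 1 - k)) (j : Fin k)
    (c : α) (h : (s : ℕ) + j < n) :
    window (Function.update z ⟨s + j, h⟩ c) s = Function.update (window z s) j c := by
  ext i
  simp only [window, Function.update_apply, Fin.ext_iff]
  split_ifs <;> first | rfl | omega

/-- The term of the window starting at `s` serves as the martingale difference at time `s + j`, the
last `z`-coordinate of that window on which `φ` depends. The first-order gain is linear in `t` and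
the loss quadratic, which pays off once `t` is small. -/
theorem sum_window_le [Fintype 𝒳] [Nonempty 𝒵] (hW : IsChannel W) {n k : ℕ} (j : Fin k)
    {p : (Fin n → 𝒵) → (Fin n → 𝒳) → ℝ} (hp : ∀ z y, 0 ≤ p z y) (hp1 : ∑ z, ∑ y, p z y = 1)
    (hpW : ∀ z y, p z y ≠ 0 → channelPow W y z ≠ 0)
    {φ : (Fin k → 𝒵) → (Fin k → 𝒳) → ℝ} (hφ : ∀ u v, |φ u v| ≤ 1)
    (hφc : ∀ u u' v, (∀ i ≤ j, u i = u' i) → φ u v = φ u' v)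
    (hφ0 : ∀ u v, ∑ c, W (v j) c * φ (Function.update u j c) v = 0)
    {t : ℝ} (ht0 : 0 ≤ t) (ht : t ≤ 1 / 2) :
    t * ∑ z, ∑ y, p z y * ∑ s : Fin (n + 1 - k), φ (window z s) (window y s) ≤
      2 * n * t ^ 2 +
      (∑ y, Real.negMulLog (∑ z, p z y) - ∑ z, Real.negMulLog (∑ y, p z y) -
        ∑ z, ∑ y, p z y * Real.log (channelPow W y z)) := by
  have hlt : ∀ s : Fin (n + 1 - k), (s : ℕ) + j < n := fun s => by omega
  let e : Fin (n + 1 - k) → Fin n := fun s => ⟨s + j, hlt s⟩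
  have he : Function.Injective e := fun s s' h => by
    have : (s : ℕ) + j = s' + j := congrArg Fin.val h
    exact Fin.ext (by omega)
  -- Times not of the form `s + j` lie near the ends of the word and receive no tilt.
  let g : Fin n → (Fin n → 𝒵) → (Fin n → 𝒳) → ℝ := fun i z y =>
    Function.extend e (fun s => t * φ (window z s) (window y s)) 0 i
  have hge : ∀ s z y, g (e s) z y = t * φ (window z s) (window y s) := fun s z y =>
    he.extend_apply _ _ _
  have hgn : ∀ i, (¬ ∃ s, e s = i) → ∀ z y, g i z y = 0 := fun i hi z y =>
    Function.extend_apply' _ _ _ hi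
  have hgt : ∀ i z y, |g i z y| ≤ t := by
    intro i z y
    by_cases hi : ∃ s, e s = i
    · obtain ⟨s, rfl⟩ := hi
      rw [hge, abs_mul, abs_of_nonneg ht0]
      exact mul_le_of_le_one_right ht0 (hφ _ _)
    · rw [hgn i hi, abs_zero]
      exact ht0
  have hsum : ∀ z y, ∑ i, g i z y = t * ∑ s, φ (window z s) (window y s) := by
    intro z y
    rw [Finset.mul_sum]
    symm
    refine Finset.sum_of_injOn e he.injOn (fun _ _ => Finset.mem_coe.2 (Finset.mem_univ _))
      (fun i _ hi => hgn i (fun ⟨s, hs⟩ => hi ⟨s, by simp, hs⟩) z y) (fun s _ => (hge s z y).symm)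
  have h := sum_martingale_le hW hp hpW (g := g) (fun i z y => (hgt i z y).trans ht)
    (by
      intro i z z' y hz
      by_cases hi : ∃ s, e s = i
      · obtain ⟨s, rfl⟩ := hi
        rw [hge, hge, hφc (window z s) (window z' s)]
        intro i hi
        refine hz _ ?_
        rw [Fin.le_def] at hi ⊢
        exact Nat.add_le_add_left hi _
      · rw [hgn i hi, hgn i hi])
    (by
      intro i z y
      by_cases hi : ∃ s, e s = i
      · obtain ⟨s, rfl⟩ := hi
        simp only [hge]
        have h0 := hφ0 (window z s) (window y s)
        simp only [mul_left_comm _ t, ← Finset.mul_sum, e, window_update]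
        exact mul_eq_zero_of_right _ h0
      · simp [hgn i hi])
  have h2 : t * ∑ z, ∑ y, p z y * ∑ s : Fin (n + 1 - k), φ (window z s) (window y s) -
      2 * n * t ^ 2 ≤ ∑ z, ∑ y, p z y * ∑ i, (g i z y - 2 * g i z y ^ 2) := by
    have h3 : 2 * n * t ^ 2 = ∑ z, ∑ y, p z y * (2 * n * t ^ 2) := by
      simp only [← Finset.sum_mul, hp1, one_mul]
    rw [h3, Finset.mul_sum, ← Finset.sum_sub_distrib]
    refine Finset.sum_le_sum fun z _ => ?_
    rw [Finset.mul_sum, ← Finset.sum_sub_distrib]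
    refine Finset.sum_le_sum fun y _ => ?_
    rw [mul_left_comm, ← hsum, ← mul_sub, Finset.sum_sub_distrib]
    refine mul_le_mul_of_nonneg_left (sub_le_sub_left ?_ _) (hp z y)
    refine (Finset.sum_le_card_nsmul Finset.univ _ (2 * t ^ 2) fun i _ => ?_).trans_eq (by
      simp; ring)
    have := sq_le_sq' (by linarith [(abs_le.1 (hgt i z y)).1]) (abs_le.1 (hgt i z y)).2
    linarith
  linarith

theorem IsChannel.le_one (hW : IsChannel W) (x : 𝒳) (z : 𝒵) : W x z ≤ 1 :=
  (Finset.single_le_sum (fun z _ => hW.1 x z) (Finset.mem_univ z)).trans_eq (hW.2 x)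

theorem partialKernel_mem_Icc (hW : IsChannel W) {k : ℕ} (a : Fin k → 𝒵) (b : Fin k → 𝒳)
    (j : ℕ) (u : Fin k → 𝒵) (v : Fin k → 𝒳) :
    0 ≤ partialKernel W a b j u v ∧ partialKernel W a b j u v ≤ 1 := by
  unfold partialKernel
  split_ifs
  · constructor
    · refine Finset.prod_nonneg fun i _ => ?_
      split_ifs <;> first | exact zero_le_one | exact le_rfl | exact hW.1 _ _
    · refine Finset.prod_le_one (fun i _ => ?_) fun i _ => ?_
      · split_ifs <;> first | exact zero_le_one | exact le_rfl | exact hW.1 _ _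
      · split_ifs <;> first | exact zero_le_one | exact le_rfl | exact hW.le_one _ _
  · exact ⟨le_rfl, zero_le_one⟩

/-- Passing from `j` to `j + 1` replaces the factor `W (b j) (a j)` by the indicator of `u j = a j`,
whose mean under `W (b j)` is that same number. The other factors `K` do not involve `u j`. -/
theorem sum_mul_partialKernel_sub (hW : IsChannel W) {k : ℕ} (a : Fin k → 𝒵) (b : Fin k → 𝒳)
    (j : Fin k) (u : Fin k → 𝒵) (v : Fin k → 𝒳) :
    ∑ c, W (v j) c * (partialKernel W a b (j + 1) (Function.update u j c) v -
      partialKernel W a b j (Function.update u j c) v) = 0 := by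
  classical
  unfold partialKernel
  by_cases hv : v = b
  · subst hv
    let K : ℝ := ∏ i ∈ Finset.univ.erase j,
      (if (i : ℕ) < j then (if u i = a i then 1 else 0) else W (v i) (a i))
    have h1 : ∀ c, ∏ i : Fin k, (if (i : ℕ) < (j : ℕ) + 1 then
        (if Function.update u j c i = a i then (1 : ℝ) else 0) else W (v i) (a i)) =
        (if c = a j then 1 else 0) * K := by
      intro c
      rw [← Finset.mul_prod_erase _ _ (Finset.mem_univ j)]
      congr 1
      · simp
      · refine Finset.prod_congr rfl fun i hi => ?_
        have hij := Finset.ne_of_mem_erase hi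
        have : (i : ℕ) ≠ j := fun h => hij (Fin.ext h)
        rw [Function.update_of_ne hij]
        have : (i : ℕ) < j + 1 ↔ (i : ℕ) < j := by omega
        simp only [this]
    have h2 : ∀ c, ∏ i : Fin k, (if (i : ℕ) < (j : ℕ) then
        (if Function.update u j c i = a i then (1 : ℝ) else 0) else W (v i) (a i)) =
        W (v j) (a j) * K := by
      intro c
      rw [← Finset.mul_prod_erase _ _ (Finset.mem_univ j)]
      congr 1
      · simp
      · refine Finset.prod_congr rfl fun i hi => ?_
        rw [Function.update_of_ne (Finset.ne_of_mem_erase hi)]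
    simp only [if_true, h1, h2, ← sub_mul, ← mul_assoc, ← Finset.sum_mul, mul_sub, mul_ite, mul_one,
      mul_zero, Finset.sum_sub_distrib, Finset.sum_ite_eq', Finset.mem_univ, hW.2, one_mul,
      sub_self, zero_mul]
  · simp [hv]

end Tilt

/-! ### Window averages of asymptotically tight sequences and inversion of the channel -/

section Average

variable {𝒳 𝒵 : Type*} {W : Matrix 𝒳 𝒵 ℝ}

theorem partialKernel_zero {k : ℕ} (a : Fin k → 𝒵) (b : Fin k → 𝒳) (u : Fin k → 𝒵)
    (v : Fin k → 𝒳) [Decidable (v = b)] :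
    partialKernel W a b 0 u v = channelPow W b a * if v = b then 1 else 0 := by
  by_cases hv : v = b <;> simp [partialKernel, channelPow, hv]

theorem partialKernel_self {k : ℕ} (a : Fin k → 𝒵) (b : Fin k → 𝒳) (u : Fin k → 𝒵)
    (v : Fin k → 𝒳) [Decidable (u = a ∧ v = b)] :
    partialKernel W a b k u v = if u = a ∧ v = b then 1 else 0 := by
  by_cases hv : v = b
  · simp only [partialKernel, hv, if_true, Fin.is_lt, Finset.prod_ite_zero, Finset.prod_const_one]
    have : (∀ i ∈ Finset.univ, u i = a i) ↔ u = a ∧ v = b := by simp [funext_iff, hv]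
    by_cases h : u = a ∧ v = b
    · rw [if_pos h, if_pos (this.2 h)]
    · rw [if_neg h, if_neg (mt this.1 h)]
  · simp [partialKernel, hv]

/-- Tensor powers preserve a right inverse. `channelPow` is applied to `U` merely as a product of
entries; `U` need not be stochastic. -/
theorem sum_channelPow_mul_eq_ite [Fintype 𝒵] [DecidableEq 𝒳] {U : Matrix 𝒵 𝒳 ℝ} (hU : W * U = 1) {k : ℕ}
    (b b' : Fin k → 𝒳) :
    ∑ a : Fin k → 𝒵, channelPow W b a * channelPow U a b' = if b = b' then 1 else 0 := by
  classical
  simp only [channelPow, ← Finset.prod_mul_distrib]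
  rw [← Fintype.prod_sum fun i c => W (b i) c * U c (b' i)]
  have : ∀ i, ∑ c, W (b i) c * U c (b' i) = if b i = b' i then 1 else 0 := fun i => by
    rw [← Matrix.mul_apply, hU, Matrix.one_apply]
  simp only [this, Finset.prod_ite_zero, Finset.prod_const_one, funext_iff, Finset.mem_univ,
    true_imp_iff]

variable [Fintype 𝒳] [Fintype 𝒵]

/-- The expectation, under the probability mass function `p` of a pair of words, of the average
of `f` over all pairs of windows of length `k`. -/
noncomputable def windowMean {n k : ℕ} (p : (Fin n → 𝒵) → (Fin n → 𝒳) → ℝ)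
    (f : (Fin k → 𝒵) → (Fin k → 𝒳) → ℝ) : ℝ :=
  (∑ z, ∑ y, p z y * ∑ s : Fin (n + 1 - k), f (window z s) (window y s)) / (n + 1 - k : ℕ)

theorem windowMean_sub {n k : ℕ} (p : (Fin n → 𝒵) → (Fin n → 𝒳) → ℝ)
    (f g : (Fin k → 𝒵) → (Fin k → 𝒳) → ℝ) :
    windowMean p (fun u v => f u v - g u v) = windowMean p f - windowMean p g := by
  simp only [windowMean, Finset.sum_sub_distrib, mul_sub, sub_div]

theorem windowMean_const_mul {n k : ℕ} (p : (Fin n → 𝒵) → (Fin n → 𝒳) → ℝ)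
    (c : ℝ) (f : (Fin k → 𝒵) → (Fin k → 𝒳) → ℝ) :
    windowMean p (fun u v => c * f u v) = c * windowMean p f := by
  simp only [windowMean, ← Finset.mul_sum, mul_left_comm _ c, mul_div_assoc]

theorem windowMean_sum {ι : Type*} (S : Finset ι) {n k : ℕ}
    (p : (Fin n → 𝒵) → (Fin n → 𝒳) → ℝ) (f : ι → (Fin k → 𝒵) → (Fin k → 𝒳) → ℝ) :
    windowMean p (fun u v => ∑ i ∈ S, f i u v) = ∑ i ∈ S, windowMean p (f i) := by
  simp only [windowMean, ← Finset.sum_div]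
  congr 1
  symm
  rw [Finset.sum_comm]
  refine Finset.sum_congr rfl fun z _ => ?_
  rw [Finset.sum_comm]
  refine Finset.sum_congr rfl fun y _ => ?_
  rw [← Finset.mul_sum, Finset.sum_comm]

/-- The excess of the entropy of `y` and the log-loss of `z` given `y` over the entropy of `z`. -/
noncomputable def entropyGap (W : Matrix 𝒳 𝒵 ℝ) {n : ℕ} (p : (Fin n → 𝒵) → (Fin n → 𝒳) → ℝ) : ℝ :=
  ∑ y, Real.negMulLog (∑ z, p z y) - ∑ z, Real.negMulLog (∑ y, p z y) -
    ∑ z, ∑ y, p z y * Real.log (channelPow W y z)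

/-- A sequence of joint distributions whose entropy gap is asymptotically at most zero. -/
structure AsymptoticallyTight (W : Matrix 𝒳 𝒵 ℝ)
    (p : (n : ℕ) → (Fin n → 𝒵) → (Fin n → 𝒳) → ℝ) : Prop where
  nonneg : ∀ n z y, 0 ≤ p n z y
  sum_eq_one : ∀ n, ∑ z, ∑ y, p n z y = 1
  gap : ∀ ε > 0, ∀ᶠ n : ℕ in atTop, (∀ z y, p n z y ≠ 0 → channelPow W y z ≠ 0) ∧
    entropyGap W (p n) ≤ n * ε

theorem AsymptoticallyTight.eventually_windowMean_lt [Nonempty 𝒵] (hW : IsChannel W)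
    {p : (n : ℕ) → (Fin n → 𝒵) → (Fin n → 𝒳) → ℝ} (h : AsymptoticallyTight W p) {k : ℕ}
    (j : Fin k) {φ : (Fin k → 𝒵) → (Fin k → 𝒳) → ℝ} (hφ : ∀ u v, |φ u v| ≤ 1)
    (hφc : ∀ u u' v, (∀ i ≤ j, u i = u' i) → φ u v = φ u' v)
    (hφ0 : ∀ u v, ∑ c, W (v j) c * φ (Function.update u j c) v = 0) {δ : ℝ} (hδ : 0 < δ) :
    ∀ᶠ n in atTop, windowMean (p n) φ < δ := by
  -- With gap at most `n t²`, the bound `2nt² + nt²` divided by `t` is `3nt`. Since `n ≤ 2(n + 1 -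
  -- k)` for `n ≥ 2k`, this is at most `6δ/20` per window.
  let t : ℝ := min (1 / 2) (δ / 20)
  have ht : 0 < t := lt_min (by norm_num) (by positivity)
  filter_upwards [h.gap (t ^ 2) (by positivity), eventually_ge_atTop (2 * k)] with n hn hk
  have hw := sum_window_le hW j (h.nonneg n) (h.sum_eq_one n) hn.1 hφ hφc hφ0 ht.le
    (min_le_left _ _)
  rw [← entropyGap] at hw
  have hN : (0 : ℝ) < (n + 1 - k : ℕ) := by
    rw [Nat.cast_pos]
    omega
  have hn2 : (n : ℝ) ≤ 2 * (n + 1 - k : ℕ) := by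
    exact_mod_cast (by omega : n ≤ 2 * (n + 1 - k))
  rw [windowMean, div_lt_iff₀ hN]
  have h20 : t ≤ δ / 20 := min_le_right _ _
  have h1 : t * ∑ z, ∑ y, p n z y * ∑ s : Fin (n + 1 - k), φ (window z s) (window y s) ≤
      t * (3 * n * t) := by
    refine hw.trans ((add_le_add le_rfl hn.2).trans_eq ?_)
    ring
  refine (le_of_mul_le_mul_left h1 ht).trans_lt ?_
  have h2 : n * t ≤ 2 * (n + 1 - k : ℕ) * (δ / 20) := mul_le_mul hn2 h20 ht.le (by positivity)
  have h3 := mul_pos hN hδ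
  linarith

/-- The hypotheses on `φ` are invariant under sign change, so the one-sided bound applies to `-φ` as
well. -/
theorem AsymptoticallyTight.tendsto_windowMean [Nonempty 𝒵] (hW : IsChannel W)
    {p : (n : ℕ) → (Fin n → 𝒵) → (Fin n → 𝒳) → ℝ} (h : AsymptoticallyTight W p) {k : ℕ}
    (j : Fin k) {φ : (Fin k → 𝒵) → (Fin k → 𝒳) → ℝ} (hφ : ∀ u v, |φ u v| ≤ 1)
    (hφc : ∀ u u' v, (∀ i ≤ j, u i = u' i) → φ u v = φ u' v)
    (hφ0 : ∀ u v, ∑ c, W (v j) c * φ (Function.update u j c) v = 0) :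
    Tendsto (fun n => windowMean (p n) φ) atTop (𝓝 0) := by
  rw [Metric.tendsto_nhds]
  intro δ hδ
  filter_upwards [h.eventually_windowMean_lt hW j hφ hφc hφ0 hδ,
    h.eventually_windowMean_lt hW j (φ := fun u v => -1 * φ u v) (by simpa using hφ)
      (fun u u' v huv => by simp only [hφc u u' v huv])
      (fun u v => by simp only [mul_left_comm _ (-1 : ℝ), ← Finset.mul_sum, hφ0, mul_zero]) hδ]
    with n h1 h2
  rw [windowMean_const_mul] at h2
  rw [Real.dist_eq, sub_zero, abs_lt]
  constructor <;> linarith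

/-- Telescoping over `j`. At `j = k` the kernel is the indicator of `(a, b)`, at `j = 0` it is
`Wᵏ(a|b)` times the indicator of `b`: asymptotically the windows of `z` are channel outputs of those
of `y`. -/
theorem AsymptoticallyTight.tendsto_windowMean_partialKernel [Nonempty 𝒵] (hW : IsChannel W)
    {p : (n : ℕ) → (Fin n → 𝒵) → (Fin n → 𝒳) → ℝ} (h : AsymptoticallyTight W p) {k : ℕ}
    (a : Fin k → 𝒵) (b : Fin k → 𝒳) : ∀ j ≤ k,
    Tendsto (fun n => windowMean (p n) (partialKernel W a b j) -
      windowMean (p n) (partialKernel W a b 0)) atTop (𝓝 0)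
  | 0, _ => by simp
  | j + 1, hj => by
    have h1 := h.tendsto_windowMean hW ⟨j, hj⟩
      (φ := fun u v => partialKernel W a b (j + 1) u v - partialKernel W a b j u v)
      (fun u v => by
        have h1 := partialKernel_mem_Icc hW a b (j + 1) u v
        have h2 := partialKernel_mem_Icc hW a b j u v
        rw [abs_le]
        constructor <;> linarith)
      (fun u u' v huv => by
        rw [partialKernel_congr a b (j + 1) v fun i hi => huv i (Nat.lt_succ_iff.1 hi),
          partialKernel_congr a b j v fun i hi => huv i hi.le])
      (sum_mul_partialKernel_sub hW a b ⟨j, hj⟩)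
    simp only [windowMean_sub] at h1
    simpa using h1.add (h.tendsto_windowMean_partialKernel hW a b j (by omega))

theorem exists_right_inverse_of_rank_eq_card [DecidableEq 𝒳]
    (hrank : W.rank = Fintype.card 𝒳) : ∃ U : Matrix 𝒵 𝒳 ℝ, W * U = 1 := by
  rw [← Matrix.mulVec_surjective_iff_exists_right_inverse]
  have : LinearMap.range W.mulVecLin = ⊤ := by
    apply Submodule.eq_top_of_finrank_eq
    rw [Module.finrank_fintype_fun_eq_card]
    exact hrank
  exact LinearMap.range_eq_top.1 this

-- The empirical law of `y` is identified from the `z`-marginal, since `P ↦ P Wᵏ` is undone by the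
-- tensor power of a right inverse of `W`; the joint law follows from the asymptotic channel
-- relation.
open Classical in
theorem AsymptoticallyTight.tendsto_windowMean_indicator [Nonempty 𝒵] (hW : IsChannel W)
    (hrank : W.rank = Fintype.card 𝒳)
    {p : (n : ℕ) → (Fin n → 𝒵) → (Fin n → 𝒳) → ℝ} (h : AsymptoticallyTight W p) {k : ℕ}
    {P : (Fin k → 𝒳) → ℝ}
    (hmarg : ∀ a : Fin k → 𝒵, Tendsto (fun n => ∑ b : Fin k → 𝒳, windowMean (p n)
      (fun u v => if u = a ∧ v = b then (1 : ℝ) else 0)) atTop (𝓝 (∑ b, P b * channelPow W b a)))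
    (a : Fin k → 𝒵) (b : Fin k → 𝒳) :
    Tendsto (fun n => windowMean (p n) (fun u v => if u = a ∧ v = b then (1 : ℝ) else 0)) atTop
      (𝓝 (P b * channelPow W b a)) := by
  obtain ⟨U, hU⟩ := exists_right_inverse_of_rank_eq_card hrank
  let q : ℕ → (Fin k → 𝒳) → ℝ := fun n b =>
    windowMean (p n) (fun (_ : Fin k → 𝒵) v => if v = b then (1 : ℝ) else 0)
  have hdiff : ∀ a b, Tendsto (fun n => windowMean (p n)
      (fun (u : Fin k → 𝒵) (v : Fin k → 𝒳) => if u = a ∧ v = b then (1 : ℝ) else 0) -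
        channelPow W b a * q n b) atTop (𝓝 0) := by
    intro a b
    have := h.tendsto_windowMean_partialKernel hW a b k le_rfl
    simpa only [funext fun u => funext fun v => partialKernel_self (W := W) a b u v,
      funext fun u => funext fun v => partialKernel_zero (W := W) a b u v,
      windowMean_const_mul] using this
  have hsum : ∀ a, Tendsto (fun n => ∑ b, channelPow W b a * q n b) atTop
      (𝓝 (∑ b, P b * channelPow W b a)) := by
    intro a
    have := (hmarg a).sub (tendsto_finsetSum Finset.univ fun b _ => hdiff a b)
    simpa only [Finset.sum_sub_distrib, sub_sub_cancel, Finset.sum_const_zero, sub_zero] using this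
  have hinv : ∀ (r : (Fin k → 𝒳) → ℝ) b',
      ∑ a, channelPow U a b' * ∑ b, r b * channelPow W b a = r b' := by
    intro r b'
    simp only [Finset.mul_sum]
    rw [Finset.sum_comm]
    have : ∀ b, ∑ a, channelPow U a b' * (r b * channelPow W b a) =
        r b * if b = b' then 1 else 0 := fun b => by
      rw [← sum_channelPow_mul_eq_ite hU, Finset.mul_sum]
      exact Finset.sum_congr rfl fun a _ => by ring
    simp [this]
  have hq : Tendsto (fun n => q n b) atTop (𝓝 (P b)) := by
    have := tendsto_finsetSum Finset.univ fun a _ => (hsum a).const_mul (channelPow U a b)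
    simpa only [hinv, mul_comm (channelPow W _ _)] using this
  have := (hdiff a b).add (hq.mul_const (channelPow W b a))
  simpa only [mul_comm (channelPow W b a), sub_add_cancel, zero_add] using this

end Average

/-! ### Expectations and marginals of finite-valued random variables -/

section Pmf

variable {Ω α β : Type*} [MeasurableSpace Ω] (μ : Measure Ω)

theorem pmfOf_nonneg (V : Ω → α) (a : α) : 0 ≤ pmfOf μ V a :=
  measureReal_nonneg

theorem pmfOf_ne_zero_of_comp [IsProbabilityMeasure μ] {V : Ω → α} (g : α → β) {a : α} (h : pmfOf μ V a ≠ 0) :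
    pmfOf μ (fun ω => g (V ω)) (g a) ≠ 0 := by
  have h1 : pmfOf μ V a ≤ pmfOf μ (fun ω => g (V ω)) (g a) :=
    measureReal_mono fun ω hω => congrArg g hω
  have h2 := lt_of_le_of_ne (pmfOf_nonneg μ V a) h.symm
  exact (h2.trans_le h1).ne'

variable [Fintype α] [MeasurableSpace α] [MeasurableSingletonClass α]
  [Fintype β] [MeasurableSpace β] [MeasurableSingletonClass β]

theorem lintegral_comp_eq_sum [IsFiniteMeasure μ] {V : Ω → α} (hV : Measurable V)
    (f : α → ℝ≥0∞) : ∫⁻ ω, f (V ω) ∂μ = ∑ a, ENNReal.ofReal (pmfOf μ V a) * f a := by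
  rw [← lintegral_map (measurable_of_finite f) hV, lintegral_fintype]
  refine Finset.sum_congr rfl fun a _ => ?_
  rw [pmfOf, ofReal_measureReal, Measure.map_apply hV (measurableSet_singleton a), mul_comm]

variable [IsProbabilityMeasure μ]

theorem integral_comp_eq_sum {V : Ω → α} (hV : Measurable V) (f : α → ℝ) :
    ∫ ω, f (V ω) ∂μ = ∑ a, pmfOf μ V a * f a := by
  have := Measure.isProbabilityMeasure_map (μ := μ) hV.aemeasurable
  rw [← integral_map hV.aemeasurable (measurable_of_finite f).aestronglyMeasurable,
    integral_fintype (Integrable.of_finite)]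
  refine Finset.sum_congr rfl fun a _ => ?_
  rw [pmfOf, map_measureReal_apply hV (measurableSet_singleton a), smul_eq_mul]

theorem sum_pmfOf {V : Ω → α} (hV : Measurable V) : ∑ a, pmfOf μ V a = 1 := by
  have := integral_comp_eq_sum μ hV (fun _ => 1)
  simpa using this.symm

theorem sum_pmfOf_mul_comp {V : Ω → α} (hV : Measurable V) (g : α → β) (f : β → ℝ) :
    ∑ a, pmfOf μ V a * f (g a) = ∑ b, pmfOf μ (fun ω => g (V ω)) b * f b := by
  rw [← integral_comp_eq_sum μ hV (fun a => f (g a)),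
    ← integral_comp_eq_sum μ (V := fun ω => g (V ω)) ((measurable_of_finite g).comp hV) f]

theorem sum_pmfOf_prod_left {V : Ω → α} {U : Ω → β} (hV : Measurable V) (hU : Measurable U)
    (a : α) : ∑ b, pmfOf μ (fun ω => (V ω, U ω)) (a, b) = pmfOf μ V a := by
  classical
  have := sum_pmfOf_mul_comp μ (hV.prodMk hU) Prod.fst (fun a' => if a' = a then 1 else 0)
  simpa [Fintype.sum_prod_type_right] using this

theorem sum_pmfOf_prod_right {V : Ω → α} {U : Ω → β} (hV : Measurable V) (hU : Measurable U)
    (b : β) : ∑ a, pmfOf μ (fun ω => (V ω, U ω)) (a, b) = pmfOf μ U b := by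
  classical
  have := sum_pmfOf_mul_comp μ (hV.prodMk hU) Prod.snd (fun b' => if b' = b then 1 else 0)
  simpa [Fintype.sum_prod_type] using this

theorem entropy_nonneg {V : Ω → α} (hV : Measurable V) : 0 ≤ entropy μ V :=
  Finset.sum_nonneg fun a _ => Real.negMulLog_nonneg (pmfOf_nonneg μ V a)
    ((Finset.single_le_sum (fun a _ => pmfOf_nonneg μ V a) (Finset.mem_univ a)).trans_eq
      (sum_pmfOf μ hV))

end Pmf

/-! ### Log-loss distortion as a log-likelihood -/

section Distortion

variable {𝒳 𝒵 : Type*} {W : Matrix 𝒳 𝒵 ℝ}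

theorem blockDistortion_logDistortion_of_eq_zero {k : ℕ} {z : Fin k → 𝒵} {y : Fin k → 𝒳}
    (h : channelPow W y z = 0) : blockDistortion (logDistortion W) z y = ⊤ := by
  obtain ⟨i, -, hi⟩ := Finset.prod_eq_zero_iff.1 h
  have : ∑ i, logDistortion W (z i) (y i) = ⊤ :=
    ENNReal.sum_eq_top.2 ⟨i, Finset.mem_univ i, if_pos hi⟩
  rw [blockDistortion, this, ENNReal.top_div_of_ne_top (ENNReal.natCast_ne_top k)]

variable [Fintype 𝒵]

theorem blockDistortion_logDistortion (hW : IsChannel W) {k : ℕ} (hk : 0 < k) {z : Fin k → 𝒵}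
    {y : Fin k → 𝒳} (h : channelPow W y z ≠ 0) :
    blockDistortion (logDistortion W) z y =
      ENNReal.ofReal (-Real.log (channelPow W y z) / k) := by
  have hi := Finset.prod_ne_zero_iff.1 h
  have : ∑ i, logDistortion W (z i) (y i) = ENNReal.ofReal (-Real.log (channelPow W y z)) := by
    rw [channelPow, Real.log_prod hi, ← Finset.sum_neg_distrib, ENNReal.ofReal_sum_of_nonneg]
    · exact Finset.sum_congr rfl fun i hi' => if_neg (hi i hi')
    · exact fun i _ => neg_nonneg.2 (Real.log_nonpos (hW.1 _ _) (hW.le_one _ _))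
  rw [blockDistortion, this, ENNReal.ofReal_div_of_pos (by exact_mod_cast hk),
    ENNReal.ofReal_natCast]

theorem channelPow_le_one (hW : IsChannel W) {n : ℕ} (x : Fin n → 𝒳) (z : Fin n → 𝒵) :
    channelPow W x z ≤ 1 :=
  Finset.prod_le_one (fun _ _ => hW.1 _ _) fun _ _ => hW.le_one _ _

variable [Fintype 𝒳]

theorem sum_mul_blockDistortion (hW : IsChannel W) {k : ℕ} (hk : 0 < k)
    {q : (Fin k → 𝒵) → (Fin k → 𝒳) → ℝ} (hq : ∀ z y, 0 ≤ q z y)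
    (h : ∀ z y, q z y ≠ 0 → channelPow W y z ≠ 0) :
    ∑ z, ∑ y, ENNReal.ofReal (q z y) * blockDistortion (logDistortion W) z y =
      ENNReal.ofReal (-(∑ z, ∑ y, q z y * Real.log (channelPow W y z)) / k) := by
  have hn : ∀ z y, 0 ≤ q z y * (-Real.log (channelPow W y z) / k) := fun z y =>
    mul_nonneg (hq z y) (div_nonneg (neg_nonneg.2
      (Real.log_nonpos (channelPow_nonneg hW _ _) (channelPow_le_one hW _ _))) k.cast_nonneg)
  have : -(∑ z, ∑ y, q z y * Real.log (channelPow W y z)) / k =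
      ∑ z, ∑ y, q z y * (-Real.log (channelPow W y z) / k) := by
    simp only [← Finset.sum_neg_distrib, Finset.sum_div, mul_div_assoc', mul_neg]
  rw [this, ENNReal.ofReal_sum_of_nonneg fun z _ => Finset.sum_nonneg fun y _ => hn z y]
  refine Finset.sum_congr rfl fun z _ => ?_
  rw [ENNReal.ofReal_sum_of_nonneg fun y _ => hn z y]
  refine Finset.sum_congr rfl fun y _ => ?_
  by_cases h0 : q z y = 0
  · simp [h0]
  · rw [blockDistortion_logDistortion hW hk (h z y h0), ENNReal.ofReal_mul (hq z y)]

/-- Finite expected distortion forces absolute continuity with respect to the channel, which every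
use of Gibbs' inequality here requires. -/
theorem channelPow_ne_zero_of_sum_ne_top {k : ℕ}
    {q : (Fin k → 𝒵) → (Fin k → 𝒳) → ℝ} (hq : ∀ z y, 0 ≤ q z y)
    (h : ∑ z, ∑ y, ENNReal.ofReal (q z y) * blockDistortion (logDistortion W) z y ≠ ⊤)
    (z : Fin k → 𝒵) (y : Fin k → 𝒳) (hzy : q z y ≠ 0) : channelPow W y z ≠ 0 := by
  intro h0
  have h1 := ENNReal.sum_ne_top.1 (ENNReal.sum_ne_top.1 h z (Finset.mem_univ z)) y
    (Finset.mem_univ y)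
  rw [blockDistortion_logDistortion_of_eq_zero h0, ENNReal.mul_top] at h1
  · exact h1 rfl
  · exact (ENNReal.ofReal_pos.2 (lt_of_le_of_ne (hq z y) hzy.symm)).ne'

end Distortion

/-! ### Words of a stationary process and of its channel output -/

section Words

variable {Ω 𝒳 𝒵 : Type*}

/-- The `n` symbols of a two-sided process from time `m` on. -/
def wordAt {α : Type*} (V : ℤ → Ω → α) (m : ℤ) (n : ℕ) (ω : Ω) : Fin n → α :=
  fun i => V (m + i) ω

theorem block_eq_wordAt {α : Type*} (V : ℤ → Ω → α) (n : ℕ) : block V n = wordAt V 1 n := by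
  funext ω i
  simp only [block, wordAt, add_comm]

variable [MeasurableSpace Ω] {μ : Measure Ω}

theorem measurable_wordAt {α : Type*} [MeasurableSpace α] {V : ℤ → Ω → α}
    (hV : ∀ i, Measurable (V i)) (m : ℤ) (n : ℕ) : Measurable (wordAt V m n) :=
  measurable_pi_lambda _ fun _ => hV _

theorem pmfOf_wordAt_eq {α : Type*} [MeasurableSpace α] [MeasurableSingletonClass α]
    {V : ℤ → Ω → α} (hV : ∀ i, Measurable (V i))
    (h : MeasurePreserving (shift : (ℤ → α) → ℤ → α) (μ.map fun ω i => V i ω)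
      (μ.map fun ω i => V i ω)) (m m' : ℤ) {n : ℕ} (a : Fin n → α) :
    pmfOf μ (wordAt V m n) a = pmfOf μ (wordAt V m' n) a := by
  have step : ∀ m, pmfOf μ (wordAt V (m + 1) n) a = pmfOf μ (wordAt V m n) a := by
    intro m
    have hm : Measurable fun ω i => V i ω := measurable_pi_lambda _ hV
    have hS : MeasurableSet {x : ℤ → α | ∀ i : Fin n, x (m + i) = a i} := by
      rw [Set.ofPred_forall]
      exact MeasurableSet.iInter fun i => measurable_pi_apply _ (measurableSet_singleton _)
    have h1 := h.measure_preimage hS.nullMeasurableSet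
    rw [Measure.map_apply hm (h.measurable hS), Measure.map_apply hm hS] at h1
    rw [pmfOf, pmfOf, measureReal_def, measureReal_def]
    convert congrArg ENNReal.toReal h1 using 3
    · ext ω
      simp only [Set.mem_preimage, Set.mem_singleton_iff, funext_iff, wordAt, Set.mem_ofPred_eq,
        shift, add_right_comm]
    · ext ω
      simp only [Set.mem_preimage, Set.mem_singleton_iff, funext_iff, wordAt, Set.mem_ofPred_eq]
  have key : ∀ m, pmfOf μ (wordAt V m n) a = pmfOf μ (wordAt V 0 n) a := fun m => by
    induction m using Int.induction_on with
    | zero => rfl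
    | succ i hi => rw [step, hi]
    | pred i hi => rw [← hi, ← step, sub_add_cancel]
  rw [key, key m']

theorem IsMemorylessOutput.pmfOf_wordAt [Fintype 𝒵] {W : Matrix 𝒳 𝒵 ℝ} {X : ℤ → Ω → 𝒳}
    {Z : ℤ → Ω → 𝒵} (h : IsMemorylessOutput μ W X Z) (m : ℤ) {n : ℕ} (z : Fin n → 𝒵)
    (x : Fin n → 𝒳) :
    pmfOf μ (fun ω => (wordAt Z m n ω, wordAt X m n ω)) (z, x) =
      pmfOf μ (wordAt X m n) x * channelPow W x z := by
  rw [channelPow, pmfOf, pmfOf]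
  convert h m n x z using 2
  · ext ω
    simp only [Set.mem_preimage, Set.mem_singleton_iff, Prod.mk.injEq, funext_iff, wordAt,
      Set.mem_ofPred_eq, forall_and, and_comm]
  · congr 1
    ext ω
    simp only [Set.mem_preimage, Set.mem_singleton_iff, funext_iff, wordAt, Set.mem_ofPred_eq]

end Words

/-! ### Subadditivity of entropy -/

section Entropy

variable {Ω α : Type*} [MeasurableSpace Ω] {μ : Measure Ω} [IsProbabilityMeasure μ]
  [Fintype α] [MeasurableSpace α] [MeasurableSingletonClass α]

/-- Gibbs' inequality against the product of the marginals. The equivalence `e` lets it apply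
directly to splitting a word in two. -/
theorem entropy_prod_le {β γ : Type*} [Fintype β] [MeasurableSpace β] [MeasurableSingletonClass β]
    [Fintype γ] [MeasurableSpace γ] [MeasurableSingletonClass γ] {V : Ω → α} (hV : Measurable V)
    (e : α ≃ β × γ) :
    entropy μ V ≤ entropy μ (fun ω => (e (V ω)).1) + entropy μ (fun ω => (e (V ω)).2) := by
  have h1 : Measurable fun ω => (e (V ω)).1 :=
    (measurable_of_finite fun a => (e a).1).comp hV
  have h2 : Measurable fun ω => (e (V ω)).2 :=
    (measurable_of_finite fun a => (e a).2).comp hV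
  have hne1 : ∀ a, pmfOf μ V a ≠ 0 → pmfOf μ (fun ω => (e (V ω)).1) (e a).1 ≠ 0 := fun a h =>
    pmfOf_ne_zero_of_comp μ (fun a => (e a).1) h
  have hne2 : ∀ a, pmfOf μ V a ≠ 0 → pmfOf μ (fun ω => (e (V ω)).2) (e a).2 ≠ 0 := fun a h =>
    pmfOf_ne_zero_of_comp μ (fun a => (e a).2) h
  have g := sum_mul_log_le_sum_mul_log (p := pmfOf μ V)
    (q := fun a => pmfOf μ (fun ω => (e (V ω)).1) (e a).1 *
      pmfOf μ (fun ω => (e (V ω)).2) (e a).2) (pmfOf_nonneg μ V)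
    (fun a => mul_nonneg (pmfOf_nonneg μ _ _) (pmfOf_nonneg μ _ _))
    (fun a h => mul_ne_zero (hne1 a h) (hne2 a h)) (by
      rw [sum_pmfOf μ hV, e.sum_comp fun b => pmfOf μ (fun ω => (e (V ω)).1) b.1 *
        pmfOf μ (fun ω => (e (V ω)).2) b.2, Fintype.sum_prod_type]
      simp only [← Finset.mul_sum, sum_pmfOf μ h2, mul_one, sum_pmfOf μ h1, le_refl])
  have h3 : ∀ a, pmfOf μ V a * Real.log (pmfOf μ (fun ω => (e (V ω)).1) (e a).1 *
      pmfOf μ (fun ω => (e (V ω)).2) (e a).2) =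
      pmfOf μ V a * Real.log (pmfOf μ (fun ω => (e (V ω)).1) (e a).1) +
        pmfOf μ V a * Real.log (pmfOf μ (fun ω => (e (V ω)).2) (e a).2) := fun a => by
    by_cases h : pmfOf μ V a = 0
    · simp [h]
    · rw [Real.log_mul (hne1 a h) (hne2 a h), mul_add]
  simp only [h3, Finset.sum_add_distrib] at g
  rw [sum_pmfOf_mul_comp μ hV (fun a => (e a).1)
      (fun b => Real.log (pmfOf μ (fun ω => (e (V ω)).1) b)),
    sum_pmfOf_mul_comp μ hV (fun a => (e a).2)
      (fun b => Real.log (pmfOf μ (fun ω => (e (V ω)).2) b))] at g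
  simp only [entropy, Real.negMulLog, neg_mul, Finset.sum_neg_distrib]
  linarith

end Entropy

/-- A stationary process `X` together with its output `Z` through the memoryless channel `W`. -/
structure StationaryModel {Ω 𝒳 𝒵 : Type*} [MeasurableSpace Ω] [Fintype 𝒳] [MeasurableSpace 𝒳]
    [Fintype 𝒵] [MeasurableSpace 𝒵] (μ : Measure Ω) (X : ℤ → Ω → 𝒳) (Z : ℤ → Ω → 𝒵)
    (W : Matrix 𝒳 𝒵 ℝ) : Prop where
  measurable_X : ∀ i, Measurable (X i)
  measurable_Z : ∀ i, Measurable (Z i)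
  stationary : MeasurePreserving (shift : (ℤ → 𝒳) → ℤ → 𝒳) (μ.map fun ω i => X i ω)
    (μ.map fun ω i => X i ω)
  isChannel : IsChannel W
  memoryless : IsMemorylessOutput μ W X Z

/-! ### The rate-distortion function at `D = H(Z₀|X₀)` and the limit of the empirical laws -/

namespace StationaryModel

variable {Ω 𝒳 𝒵 : Type*} [MeasurableSpace Ω]
    [Fintype 𝒳] [MeasurableSpace 𝒳] [Fintype 𝒵] [MeasurableSpace 𝒵] {μ : Measure Ω}
    {X : ℤ → Ω → 𝒳} {Z : ℤ → Ω → 𝒵} {W : Matrix 𝒳 𝒵 ℝ} (M : StationaryModel μ X Z W)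
include M

theorem pmfOf_block {n : ℕ} (z : Fin n → 𝒵) (x : Fin n → 𝒳) :
    pmfOf μ (fun ω => (block Z n ω, block X n ω)) (z, x) =
      pmfOf μ (block X n) x * channelPow W x z := by
  rw [block_eq_wordAt, block_eq_wordAt, M.memoryless.pmfOf_wordAt]

theorem measurable_block_X (n : ℕ) : Measurable (block X n) := by
  rw [block_eq_wordAt]
  exact measurable_wordAt M.measurable_X 1 n

theorem measurable_block_Z (n : ℕ) : Measurable (block Z n) := by
  rw [block_eq_wordAt]
  exact measurable_wordAt M.measurable_Z 1 n

theorem channelPow_ne_zero {n : ℕ} (z : Fin n → 𝒵) (x : Fin n → 𝒳)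
    (h : pmfOf μ (fun ω => (block Z n ω, block X n ω)) (z, x) ≠ 0) : channelPow W x z ≠ 0 := by
  rw [M.pmfOf_block] at h
  exact right_ne_zero_of_mul h

variable [MeasurableSingletonClass 𝒳]

theorem pmfOf_pair (i : ℤ) (c : 𝒵) (e : 𝒳) :
    pmfOf μ (fun ω => (Z i ω, X i ω)) (c, e) = pmfOf μ (X 0) e * W e c := by
  have h := M.memoryless.pmfOf_wordAt i (n := 1) (fun _ => c) fun _ => e
  rw [pmfOf_wordAt_eq M.measurable_X M.stationary i 0] at h
  have h1 : pmfOf μ (fun ω => (wordAt Z i 1 ω, wordAt X i 1 ω)) (fun _ => c, fun _ => e) =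
      pmfOf μ (fun ω => (Z i ω, X i ω)) (c, e) := by
    rw [pmfOf, pmfOf]
    congr 1
    ext ω
    simp [wordAt, funext_iff]
  have h2 : pmfOf μ (wordAt X 0 1) (fun _ => e) = pmfOf μ (X 0) e := by
    rw [pmfOf, pmfOf]
    congr 1
    ext ω
    simp [wordAt, funext_iff]
  rw [← h1, h, h2]
  simp [channelPow]

theorem condEntropy_eq :
    condEntropy μ (Z 0) (X 0) = -∑ e, ∑ c, pmfOf μ (X 0) e * W e c * Real.log (W e c) := by
  rw [condEntropy, ← Finset.sum_neg_distrib]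
  refine Finset.sum_congr rfl fun e _ => ?_
  rw [Finset.mul_sum, ← Finset.sum_neg_distrib]
  refine Finset.sum_congr rfl fun c _ => ?_
  rw [M.pmfOf_pair]
  by_cases h : pmfOf μ (X 0) e = 0
  · simp [h]
  · rw [mul_div_cancel_left₀ _ h, Real.negMulLog]
    ring

theorem condEntropy_nonneg : 0 ≤ condEntropy μ (Z 0) (X 0) := by
  rw [M.condEntropy_eq, neg_nonneg]
  exact Finset.sum_nonpos fun e _ => Finset.sum_nonpos fun c _ =>
    mul_nonpos_of_nonneg_of_nonpos (mul_nonneg (pmfOf_nonneg μ _ _) (M.isChannel.1 _ _))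
      (Real.log_nonpos (M.isChannel.1 _ _) (M.isChannel.le_one _ _))

variable [MeasurableSingletonClass 𝒵] [IsProbabilityMeasure μ]

theorem pmfOf_wordAt (m : ℤ) {n : ℕ} (z : Fin n → 𝒵) :
    pmfOf μ (wordAt Z m n) z = ∑ x, pmfOf μ (block X n) x * channelPow W x z := by
  rw [← sum_pmfOf_prod_left μ (measurable_wordAt M.measurable_Z m n)
    (measurable_wordAt M.measurable_X m n)]
  refine Finset.sum_congr rfl fun x _ => ?_
  rw [M.memoryless.pmfOf_wordAt, block_eq_wordAt, pmfOf_wordAt_eq M.measurable_X M.stationary m 1]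

theorem pmfOf_wordAt_Z_eq (m : ℤ) {n : ℕ} (z : Fin n → 𝒵) :
    pmfOf μ (wordAt Z m n) z = pmfOf μ (block Z n) z := by
  rw [block_eq_wordAt, M.pmfOf_wordAt, M.pmfOf_wordAt]

theorem sum_mul_log_channelPow (n : ℕ) :
    ∑ z, ∑ x, pmfOf μ (fun ω => (block Z n ω, block X n ω)) (z, x) *
      Real.log (channelPow W x z) = -(n * condEntropy μ (Z 0) (X 0)) := by
  have h1 : ∀ (z : Fin n → 𝒵) (x : Fin n → 𝒳),
      pmfOf μ (fun ω => (block Z n ω, block X n ω)) (z, x) * Real.log (channelPow W x z) =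
      ∑ i, pmfOf μ (fun ω => (block Z n ω, block X n ω)) (z, x) * Real.log (W (x i) (z i)) := by
    intro z x
    by_cases h : pmfOf μ (fun ω => (block Z n ω, block X n ω)) (z, x) = 0
    · simp [h]
    · rw [channelPow, Real.log_prod (Finset.prod_ne_zero_iff.1 (M.channelPow_ne_zero z x h)),
        Finset.mul_sum]
  have hm : Measurable fun ω => (block Z n ω, block X n ω) :=
    (M.measurable_block_Z n).prodMk (M.measurable_block_X n)
  have h2 : ∀ i : Fin n, ∑ a : (Fin n → 𝒵) × (Fin n → 𝒳),
      pmfOf μ (fun ω => (block Z n ω, block X n ω)) a * Real.log (W (a.2 i) (a.1 i)) =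
      -condEntropy μ (Z 0) (X 0) := by
    intro i
    rw [M.condEntropy_eq, neg_neg]
    have h3 := sum_pmfOf_mul_comp μ hm
      (fun a : (Fin n → 𝒵) × (Fin n → 𝒳) => (a.1 i, a.2 i)) (fun b => Real.log (W b.2 b.1))
    rw [h3, Fintype.sum_prod_type_right]
    refine Finset.sum_congr rfl fun e _ => Finset.sum_congr rfl fun c _ => ?_
    rw [← M.pmfOf_pair ((i : ℤ) + 1)]
    rfl
  simp only [h1]
  rw [← Fintype.sum_prod_type' (f := fun (z : Fin n → 𝒵) (x : Fin n → 𝒳) => ∑ i,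
    pmfOf μ (fun ω => (block Z n ω, block X n ω)) (z, x) * Real.log (W (x i) (z i))),
    Finset.sum_comm, Finset.sum_congr rfl fun i _ => h2 i]
  simp

/-- The second half of the split word starts at time `m + 1`; stationarity gives it the law of the
first `n` symbols. -/
theorem subadditive_entropy : Subadditive fun n => entropy μ (block Z n) := by
  intro m n
  have h := entropy_prod_le (μ := μ) (M.measurable_block_Z (m + n)) (Fin.appendEquiv m n).symm
  refine h.trans_eq ?_
  have h1 : (fun ω => ((Fin.appendEquiv m n).symm (block Z (m + n) ω)).1) = block Z m := by
    funext ω i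
    simp [Fin.appendEquiv, block]
  have h2 : (fun ω => ((Fin.appendEquiv m n).symm (block Z (m + n) ω)).2) =
      wordAt Z (m + 1) n := by
    funext ω i
    simp [Fin.appendEquiv, block, wordAt, add_right_comm]
  rw [h1, h2]
  simp only [entropy, M.pmfOf_wordAt_Z_eq]

theorem tendsto_entropy_div : ∃ h : ℝ,
    Tendsto (fun n : ℕ => entropy μ (block Z n) / n) atTop (𝓝 h) :=
  ⟨_, M.subadditive_entropy.tendsto_lim ⟨0, by
    rintro _ ⟨n, rfl⟩
    exact div_nonneg (entropy_nonneg μ (M.measurable_block_Z n)) n.cast_nonneg⟩⟩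

theorem mutualInfo_block (n : ℕ) :
    mutualInfo (fun z x => pmfOf μ (fun ω => (block Z n ω, block X n ω)) (z, x)) =
      entropy μ (block Z n) - n * condEntropy μ (Z 0) (X 0) := by
  have h1 := M.sum_mul_log_channelPow n
  have h2 : entropy μ (block Z n) = -∑ z, ∑ x,
      pmfOf μ (fun ω => (block Z n ω, block X n ω)) (z, x) * Real.log (pmfOf μ (block Z n) z) := by
    simp only [← Finset.sum_mul, entropy, Real.negMulLog, neg_mul, Finset.sum_neg_distrib,
      sum_pmfOf_prod_left μ (M.measurable_block_Z n) (M.measurable_block_X n)]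
  rw [h2, ← neg_add_eq_sub, ← h1, ← sub_eq_add_neg, ← Finset.sum_sub_distrib, mutualInfo]
  refine Finset.sum_congr rfl fun z _ => ?_
  rw [← Finset.sum_sub_distrib]
  refine Finset.sum_congr rfl fun x _ => ?_
  rw [sum_pmfOf_prod_left μ (M.measurable_block_Z n) (M.measurable_block_X n),
    sum_pmfOf_prod_right μ (M.measurable_block_Z n) (M.measurable_block_X n)]
  by_cases h : pmfOf μ (fun ω => (block Z n ω, block X n ω)) (z, x) = 0
  · simp [h]
  · have hz : pmfOf μ (block Z n) z ≠ 0 := pmfOf_ne_zero_of_comp μ Prod.fst h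
    have hx : pmfOf μ (block X n) x ≠ 0 := pmfOf_ne_zero_of_comp μ Prod.snd h
    rw [← mul_sub, ← Real.log_div (M.channelPow_ne_zero z x h) hz, M.pmfOf_block, mul_comm
      (pmfOf μ (block Z n) z), mul_div_mul_left _ _ hx]

/-- The posterior of `Xᵏ` given `Zᵏ` meets the distortion constraint with equality and has
information `H(Zᵏ) - kD`. Conversely, the variational bound with `r = Wᵏ` makes the distortion
itself a lower bound for the information. -/
theorem rateDistortion_eq {k : ℕ} (hk : 0 < k) :
    rateDistortion (logDistortion W) (pmfOf μ (block Z k))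
      (ENNReal.ofReal (condEntropy μ (Z 0) (X 0))) =
      ((entropy μ (block Z k) / k - condEntropy μ (Z 0) (X 0) : ℝ) : EReal) := by
  classical
  have hk' : (0 : ℝ) < k := by exact_mod_cast hk
  apply le_antisymm
  · obtain ⟨ω₀⟩ : Nonempty Ω := nonempty_of_isProbabilityMeasure μ
    have : Nonempty (Fin k → 𝒳) := ⟨block X k ω₀⟩
    let J : (Fin k → 𝒵) → (Fin k → 𝒳) → ℝ := fun z x =>
      pmfOf μ (fun ω => (block Z k ω, block X k ω)) (z, x)
    have hJ0 : ∀ z x, 0 ≤ J z x := fun z x => pmfOf_nonneg μ _ _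
    have hJ1 : ∀ z, ∑ x, J z x = pmfOf μ (block Z k) z :=
      sum_pmfOf_prod_left μ (M.measurable_block_Z k) (M.measurable_block_X k)
    -- On words `z` of probability zero the posterior is undefined; the uniform law keeps `V`
    -- stochastic.
    let V : Matrix (Fin k → 𝒵) (Fin k → 𝒳) ℝ := fun z x =>
      if pmfOf μ (block Z k) z = 0 then (Fintype.card (Fin k → 𝒳) : ℝ)⁻¹
      else J z x / pmfOf μ (block Z k) z
    have hV : IsChannel V := by
      constructor
      · intro z x
        simp only [V]
        split_ifs
        · positivity
        · exact div_nonneg (hJ0 z x) (pmfOf_nonneg μ _ _)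
      · intro z
        simp only [V]
        split_ifs with h
        · rw [Finset.sum_const, Finset.card_univ, nsmul_eq_mul, mul_inv_cancel₀
            (Nat.cast_ne_zero.2 Fintype.card_ne_zero)]
        · rw [← Finset.sum_div, hJ1, div_self h]
    have hJV : ∀ z x, pmfOf μ (block Z k) z * V z x = J z x := by
      intro z x
      simp only [V]
      split_ifs with h
      · rw [h, zero_mul]
        by_contra h0
        exact pmfOf_ne_zero_of_comp μ Prod.fst (Ne.symm h0) h
      · rw [mul_div_cancel₀ _ h]
    refine iInf₂_le_of_le V hV (iInf_le_of_le ?_ ?_)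
    · simp only [hJV]
      rw [sum_mul_blockDistortion M.isChannel hk hJ0 M.channelPow_ne_zero,
        M.sum_mul_log_channelPow, neg_neg, mul_div_cancel_left₀ _ hk'.ne']
    · simp only [hJV, J]
      rw [M.mutualInfo_block, sub_div, mul_div_cancel_left₀ _ hk'.ne']
  · refine le_iInf fun V => le_iInf fun hV => le_iInf fun hD => ?_
    have hq : ∀ z y, 0 ≤ pmfOf μ (block Z k) z * V z y := fun z y =>
      mul_nonneg (pmfOf_nonneg μ _ _) (hV.1 z y)
    have hne := channelPow_ne_zero_of_sum_ne_top hq (hD.trans_lt ENNReal.ofReal_lt_top).ne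
    rw [sum_mul_blockDistortion M.isChannel hk hq hne,
      ENNReal.ofReal_le_ofReal_iff M.condEntropy_nonneg, div_le_iff₀ hk'] at hD
    have h := sum_mul_log_add_entropy_le_mutualInfo hq
      (fun z y => channelPow_nonneg M.isChannel y z) (sum_channelPow M.isChannel) hne
    simp only [← Finset.mul_sum, hV.2, mul_one] at h hD
    rw [← entropy] at h
    rw [EReal.coe_le_coe_iff, le_div_iff₀ hk', sub_mul, div_mul_cancel₀ _ hk'.ne']
    linarith

theorem tendsto_rateDistortion {h : ℝ}
    (hh : Tendsto (fun n : ℕ => entropy μ (block Z n) / n) atTop (𝓝 h)) :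
    Tendsto (fun k : ℕ => rateDistortion (logDistortion W) (pmfOf μ (block Z k))
      (ENNReal.ofReal (condEntropy μ (Z 0) (X 0)))) atTop
      (𝓝 ((h - condEntropy μ (Z 0) (X 0) : ℝ) : EReal)) := by
  refine Tendsto.congr' ?_ ((continuous_coe_real_ereal.tendsto _).comp (hh.sub_const _))
  filter_upwards [eventually_gt_atTop 0] with k hk
  exact (M.rateDistortion_eq hk).symm

/-- The rate is at most `h - D`, the log-loss at most `D` and the entropy of `Zⁿ` at least `h`, each
per symbol and up to `ε / 3`; in the gap `h` and `D` cancel. -/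
theorem asymptoticallyTight {h : ℝ}
    (hh : Tendsto (fun n : ℕ => entropy μ (block Z n) / n) atTop (𝓝 h))
    {Y : (n : ℕ) → Ω → Fin n → 𝒳} (hY : ∀ n, Measurable (Y n))
    (hgood : IsGood μ (logDistortion W) Z Y (h - condEntropy μ (Z 0) (X 0))
      (ENNReal.ofReal (condEntropy μ (Z 0) (X 0)))) :
    AsymptoticallyTight W fun n z y => pmfOf μ (fun ω => (block Z n ω, Y n ω)) (z, y) where
  nonneg _ _ _ := pmfOf_nonneg μ _ _
  sum_eq_one n := by
    simp only [sum_pmfOf_prod_left μ (M.measurable_block_Z n) (hY n)]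
    exact sum_pmfOf μ (M.measurable_block_Z n)
  gap ε hε := by
    have h1 : ∀ᶠ n : ℕ in atTop, ((entropy μ (Y n) / n : ℝ) : EReal) <
        ((h - condEntropy μ (Z 0) (X 0) + ε / 3 : ℝ) : EReal) :=
      eventually_lt_of_limsup_lt (hgood.1.trans_lt (EReal.coe_lt_coe_iff.2 (by linarith)))
    have h2 : ∀ᶠ n : ℕ in atTop, ∫⁻ ω, blockDistortion (logDistortion W) (block Z n ω) (Y n ω) ∂μ <
        ENNReal.ofReal (condEntropy μ (Z 0) (X 0) + ε / 3) :=
      eventually_lt_of_limsup_lt (hgood.2.trans_lt ((ENNReal.ofReal_lt_ofReal_iff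
        (by linarith [M.condEntropy_nonneg])).2 (by linarith)))
    have h3 : ∀ᶠ n : ℕ in atTop, h - ε / 3 < entropy μ (block Z n) / n :=
      hh.eventually (lt_mem_nhds (by linarith))
    filter_upwards [h1, h2, h3, eventually_gt_atTop 0] with n h1 h2 h3 hn
    have hn' : (0 : ℝ) < n := by exact_mod_cast hn
    rw [lintegral_comp_eq_sum μ ((M.measurable_block_Z n).prodMk (hY n))
      (fun a => blockDistortion (logDistortion W) a.1 a.2), Fintype.sum_prod_type] at h2
    have hp : ∀ z y, 0 ≤ pmfOf μ (fun ω => (block Z n ω, Y n ω)) (z, y) := fun z y =>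
      pmfOf_nonneg μ _ _
    have hne := channelPow_ne_zero_of_sum_ne_top hp (h2.trans ENNReal.ofReal_lt_top).ne
    refine ⟨hne, ?_⟩
    rw [sum_mul_blockDistortion M.isChannel hn hp hne, ENNReal.ofReal_lt_ofReal_iff
      (by linarith [M.condEntropy_nonneg]), div_lt_iff₀ hn'] at h2
    rw [EReal.coe_lt_coe_iff, div_lt_iff₀ hn'] at h1
    rw [lt_div_iff₀ hn'] at h3
    simp only [entropyGap, sum_pmfOf_prod_left μ (M.measurable_block_Z n) (hY n),
      sum_pmfOf_prod_right μ (M.measurable_block_Z n) (hY n)]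
    rw [← entropy, ← entropy]
    nlinarith

theorem expEmpirical_eq_windowMean [DecidableEq 𝒳] [DecidableEq 𝒵]
    {Y : (n : ℕ) → Ω → Fin n → 𝒳} (hY : ∀ n, Measurable (Y n)) {k : ℕ} (n : ℕ)
    (a : Fin k → 𝒵) (b : Fin k → 𝒳) :
    expEmpirical μ Z Y k n a b = windowMean
      (fun z y => pmfOf μ (fun ω => (block Z n ω, Y n ω)) (z, y))
      (fun u v => if u = a ∧ v = b then (1 : ℝ) else 0) := by
  rw [expEmpirical, integral_comp_eq_sum μ ((M.measurable_block_Z n).prodMk (hY n))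
    (fun c => empirical k c.1 c.2 a b), Fintype.sum_prod_type, windowMean]
  simp only [empirical, Finset.sum_div, mul_div_assoc]
  congr! 6

/-- By stationarity each window of `Z` has the law of `Zᵏ`, so the marginal is exact and not merely
asymptotic. For `k > n` there are no windows and the quotient is the default `0`. -/
theorem sum_expEmpirical {Y : (n : ℕ) → Ω → Fin n → 𝒳} (hY : ∀ n, Measurable (Y n)) {k n : ℕ}
    (hkn : k ≤ n) (a : Fin k → 𝒵) :
    ∑ b, expEmpirical μ Z Y k n a b = pmfOf μ (block Z k) a := by
  classical
  have hN : ((n + 1 - k : ℕ) : ℝ) ≠ 0 := by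
    rw [Nat.cast_ne_zero]
    omega
  simp only [M.expEmpirical_eq_windowMean hY]
  rw [← windowMean_sum, windowMean, div_eq_iff hN]
  have h1 : ∀ (u : Fin k → 𝒵) (v : Fin k → 𝒳),
      ∑ b, (if u = a ∧ v = b then (1 : ℝ) else 0) = if u = a then 1 else 0 := fun u v => by
    by_cases h : u = a <;> simp [h]
  simp only [h1, ← Finset.sum_mul, sum_pmfOf_prod_left μ (M.measurable_block_Z n) (hY n)]
  simp only [Finset.mul_sum]
  rw [Finset.sum_comm]
  have h2 : ∀ s : Fin (n + 1 - k),
      ∑ z, pmfOf μ (block Z n) z * (if window z s = a then (1 : ℝ) else 0) =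
        pmfOf μ (block Z k) a := by
    intro s
    rw [sum_pmfOf_mul_comp μ (M.measurable_block_Z n) (fun z => window z s)
      (fun u => if u = a then (1 : ℝ) else 0)]
    have : (fun ω => window (block Z n ω) s) = wordAt Z (s + 1) k := by
      funext ω i
      simp [window, block, wordAt, add_right_comm]
    simp [this, M.pmfOf_wordAt_Z_eq]
  simp only [h2, Finset.sum_const, Finset.card_univ, Fintype.card_fin, nsmul_eq_mul]
  rw [mul_comm]

theorem tendsto_expEmpirical (hrank : W.rank = Fintype.card 𝒳) {h : ℝ}
    (hh : Tendsto (fun n : ℕ => entropy μ (block Z n) / n) atTop (𝓝 h))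
    {Y : (n : ℕ) → Ω → Fin n → 𝒳} (hY : ∀ n, Measurable (Y n))
    (hgood : IsGood μ (logDistortion W) Z Y (h - condEntropy μ (Z 0) (X 0))
      (ENNReal.ofReal (condEntropy μ (Z 0) (X 0)))) {k : ℕ}
    (a : Fin k → 𝒵) (b : Fin k → 𝒳) :
    Tendsto (fun n => expEmpirical μ Z Y k n a b) atTop
      (𝓝 (pmfOf μ (fun ω => (block Z k ω, block X k ω)) (a, b))) := by
  classical
  obtain ⟨ω₀⟩ : Nonempty Ω := nonempty_of_isProbabilityMeasure μ
  have : Nonempty 𝒵 := ⟨Z 0 ω₀⟩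
  have ht := (M.asymptoticallyTight hh hY hgood).tendsto_windowMean_indicator M.isChannel hrank
    (P := pmfOf μ (block X k)) (fun a => by
      refine tendsto_nhds_of_eventually_eq ?_
      filter_upwards [eventually_ge_atTop k] with n hn
      rw [← M.pmfOf_wordAt 1, ← block_eq_wordAt, ← M.sum_expEmpirical hY hn]
      refine Finset.sum_congr rfl fun b _ => ?_
      rw [M.expEmpirical_eq_windowMean hY]) a b
  rw [M.pmfOf_block]
  refine ht.congr fun n => ?_
  rw [M.expEmpirical_eq_windowMean hY]

end StationaryModel

end CompressionDenoising

theorem mainTheorem3 {Ω 𝒳 𝒵 : Type*} [MeasurableSpace Ω]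
    [Fintype 𝒳] [MeasurableSpace 𝒳] [MeasurableSingletonClass 𝒳]
    [Fintype 𝒵] [MeasurableSpace 𝒵] [MeasurableSingletonClass 𝒵]
    (μ : Measure Ω) [IsProbabilityMeasure μ]
    (X : ℤ → Ω → 𝒳) (Z : ℤ → Ω → 𝒵)
    (hX : ∀ i, Measurable (X i)) (hZ : ∀ i, Measurable (Z i))
    (hXerg : Ergodic (shift : (ℤ → 𝒳) → ℤ → 𝒳) (μ.map fun ω i => X i ω))
    (W : Matrix 𝒳 𝒵 ℝ) (hW : IsChannel W) (hXZ : IsMemorylessOutput μ W X Z)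
    (hrank : W.rank = Fintype.card 𝒳)
    (D : ℝ≥0∞) (hD : D = ENNReal.ofReal (condEntropy μ (Z 0) (X 0))) :
    ∃ R : ℝ,
      Tendsto (fun k : ℕ => rateDistortion (logDistortion W) (pmfOf μ (block Z k)) D)
        atTop (𝓝 (R : EReal)) ∧
      ∀ Y : (n : ℕ) → Ω → Fin n → 𝒳, (∀ n, Measurable (Y n)) →
        IsGood μ (logDistortion W) Z Y R D →
        ∀ k : ℕ, 1 ≤ k →
          (∀ (a : Fin k → 𝒵) (b : Fin k → 𝒳),
            Tendsto (fun n : ℕ => expEmpirical μ Z Y k n a b) atTop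
              (𝓝 (pmfOf μ (fun ω => (block Z k ω, block X k ω)) (a, b)))) ∧
          (∀ (a : Fin k → 𝒵) (b : Fin k → 𝒳), 0 < pmfOf μ (block Z k) a →
            Tendsto
              (fun n : ℕ => expEmpirical μ Z Y k n a b / ∑ b', expEmpirical μ Z Y k n a b') atTop
              (𝓝 (pmfOf μ (fun ω => (block Z k ω, block X k ω)) (a, b) /
                pmfOf μ (block Z k) a))) := by
  subst hD
  have M : StationaryModel μ X Z W := ⟨hX, hZ, hXerg.toMeasurePreserving, hW, hXZ⟩
  obtain ⟨h, hh⟩ := M.tendsto_entropy_div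
  refine ⟨_, M.tendsto_rateDistortion hh, fun Y hY hgood k _ => ?_⟩
  have key := fun a b => M.tendsto_expEmpirical hrank hh hY hgood (k := k) a b
  -- The normalizing sum equals `P(Zᵏ = a)` as soon as `n ≥ k`.
  refine ⟨key, fun a b ha => (key a b).div (tendsto_nhds_of_eventually_eq ?_) ha.ne'⟩
  filter_upwards [eventually_ge_atTop k] with n hn
  exact M.sum_expEmpirical hY hn a
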